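/- Let $n\ge 2$ and let $V=\mathbb R^{1,n+1}$ be Minkowski space with inner product $\langle\cdot,\cdot\rangle$ and a fixed Witt basis $(e_-,e_1,\dots,e_n,e_+)$, i.e. $\langle e_-,e_+\rangle=1$, $\langle e_i,e_j\rangle=\delta_{ij}$, and all other products of basis vectors vanish. Put $V_-=\mathbb R e_-$, $V_0=\mathrm{span}(e_1,\dots,e_n)\simeq\mathbb R^n$, and, in the dual space, $V^+=\mathbb R\,\langle e_-,\cdot\rangle$, $V^0=\mathrm{span}(\langle e_1,\cdot\rangle,\dots,\langle e_n,\cdot\rangle)$. Let $\mathfrak p=(\mathbb R\oplus\mathfrak{so}(n))\ltimes\mathbb R^n$ be the stabiliser of the line $\mathbb R e_-$ in $\mathfrak g=\mathfrak{so}(V)\simeq\mathfrak{so}(1,n+1)$, and let $\mathrm{pr}_{\mathbb R}:\mathfrak p\to\mathbb R$ be the projection given by $Xe_-=\mathrm{pr}_{\mathbb R}(X)\,e_-$. Let $\mathfrak h\subseteq\mathfrak p$ be an indecomposable Lie subalgebra, i.e. no non-degenerate subspace of $V$ other than $\{0\}$ and $V$ is invariant under $\mathfrak h$. Let $W$ be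 a trivial $\mathfrak h$-submodule of the torsion module $\Lambda^2V^*\otimes V$, i.e. a linear subspace such that every $T\in W$ satisfies $X\,T(u,v)-T(Xu,v)-T(u,Xv)=0$ for all $X\in\mathfrak h$ and $u,v\in V$. Then: 1. If $\mathrm{pr}_{\mathbb R}(\mathfrak h)\neq\{0\}$, then $W=\{0\}$. 2. If $\mathrm{pr}_{\mathbb R}(\mathfrak h)=\{0\}$ (i.e. $\mathfrak h\subseteq\mathfrak{so}(n)\ltimes\mathbb R^n$), then $$W\subseteq\big((V^*\wedge V^+)\oplus(V^0\wedge V^0)\big)\otimes V_-\ \oplus\ (V^0\wedge V^+)\otimes V_0 .$$ 3. For every $T\in W$, the formula $\omega(x,y)=\langle T(x,y),e_+\rangle$ defines a skew-symmetric bilinear form on $V_0$, there is $b\in\mathbb R$ with $T(e_+,e_-)=b\,e_-$, and $$\langle T(e_+,x),y\rangle=b\,x^\top y+\omega(x,y)\qquad\text{for all }x,y\in V_0 .$$ -/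

import Mathlib

attribute [local instance 100] LieRing.ofAssociativeRing

noncomputable section

namespace Minkowski

/-- The Minkowski space `ℝ^{1,n+1}` of dimension `n + 2`, in coordinates with respect to a Witt
basis `(e₋, e₁, …, eₙ, e₊)`: the triple `(a, x, b)` is the vector `a e₋ + ∑ xᵢ eᵢ + b e₊`. -/
abbrev Space (n : ℕ) : Type := ℝ × EuclideanSpace ℝ (Fin n) × ℝ

/-- The null vector `e₋`. -/
def eMinus (n : ℕ) : Space n := (1, 0, 0)

/-- The null vector `e₊`. -/
def ePlus (n : ℕ) : Space n := (0, 0, 1)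

/-- The inclusion of `ℝⁿ` as the Euclidean summand `V₀ = span (e₁, …, eₙ)`. -/
def incl (n : ℕ) : EuclideanSpace ℝ (Fin n) →ₗ[ℝ] Space n :=
  LinearMap.inr ℝ ℝ (EuclideanSpace ℝ (Fin n) × ℝ) ∘ₗ
    LinearMap.inl ℝ (EuclideanSpace ℝ (Fin n)) ℝ

/-- The Minkowski inner product: `⟨e₋, e₊⟩ = 1`, `⟨eᵢ, eⱼ⟩ = δᵢⱼ`, all other products of basis
vectors are zero. -/
def form (n : ℕ) : LinearMap.BilinForm ℝ (Space n) :=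
  LinearMap.mk₂ ℝ (fun u v => u.1 * v.2.2 + inner ℝ u.2.1 v.2.1 + u.2.2 * v.1)
    (by intro u u' v; simp [inner_add_left]; ring)
    (by intro c u v; simp [inner_smul_left]; ring)
    (by intro u v v'; simp [inner_add_right]; ring)
    (by intro c u v; simp [inner_smul_right]; ring)

/-- The line `V₋ = ℝ e₋`. -/
def VMinus (n : ℕ) : Submodule ℝ (Space n) := Submodule.span ℝ {eMinus n}

/-- The subspace `V₀ = span (e₁, …, eₙ)`. -/
def VZero (n : ℕ) : Submodule ℝ (Space n) := LinearMap.range (incl n)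

/-- The line `V⁺ = ℝ e⁺` in the dual space, where `e⁺ = ⟨e₋, ·⟩` is dual to `e₊`. -/
def dualPlus (n : ℕ) : Submodule ℝ (Module.Dual ℝ (Space n)) :=
  Submodule.span ℝ {form n (eMinus n)}

/-- The subspace `V⁰ = span (e¹, …, eⁿ)` of the dual space, where `eⁱ = ⟨eᵢ, ·⟩`. -/
def dualZero (n : ℕ) : Submodule ℝ (Module.Dual ℝ (Space n)) :=
  Submodule.span ℝ (Set.range fun i : Fin n => form n (incl n (EuclideanSpace.single i 1)))

/-- The parabolic subalgebra `𝔭 = (ℝ ⊕ 𝔰𝔬(n)) ⋉ ℝⁿ`: the stabiliser of the null line `ℝ e₋` in the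
Lie algebra `𝔤 = 𝔰𝔬(1, n+1)` of skew-adjoint endomorphisms of Minkowski space. -/
def parabolic (n : ℕ) : LieSubalgebra ℝ (Module.End ℝ (Space n)) where
  carrier := {X | X ∈ skewAdjointLieSubalgebra (form n) ∧ X (eMinus n) ∈ VMinus n}
  add_mem' := by
    rintro X Y ⟨hX, hX'⟩ ⟨hY, hY'⟩
    exact ⟨add_mem hX hY, add_mem hX' hY'⟩
  zero_mem' := ⟨zero_mem _, zero_mem (VMinus n)⟩
  smul_mem' := by
    rintro c X ⟨hX, hX'⟩
    exact ⟨(skewAdjointLieSubalgebra (form n)).smul_mem c hX, (VMinus n).smul_mem c hX'⟩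
  lie_mem' := by
    rintro X Y ⟨hX, hX'⟩ ⟨hY, hY'⟩
    refine ⟨LieSubalgebra.lie_mem _ hX hY, ?_⟩
    obtain ⟨a, ha⟩ := Submodule.mem_span_singleton.1 hX'
    obtain ⟨b, hb⟩ := Submodule.mem_span_singleton.1 hY'
    have hXY : ⁅X, Y⁆ (eMinus n) = 0 := by
      rw [LieRing.of_associative_ring_bracket, LinearMap.sub_apply, Module.End.mul_apply,
        Module.End.mul_apply, ← ha, ← hb, map_smul, map_smul, ← ha, ← hb, smul_comm, sub_self]
    exact hXY ▸ zero_mem (VMinus n)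

/-- The projection `pr_ℝ`, to be used on `𝔭`: the coefficient `a` in `X e₋ = a e₋`, which is the
upper left entry of the matrix of `X` in the Witt basis. -/
def prReal (n : ℕ) : Module.End ℝ (Space n) →ₗ[ℝ] ℝ where
  toFun X := (X (eMinus n)).1
  map_add' _ _ := rfl
  map_smul' _ _ := rfl

/-- A Lie algebra of endomorphisms of Minkowski space is indecomposable if it leaves invariant no
non-degenerate subspace other than the two trivial ones. -/
def IsIndecomposable {n : ℕ} (h : LieSubalgebra ℝ (Module.End ℝ (Space n))) : Prop :=
  ∀ U : Submodule ℝ (Space n), (∀ X ∈ h, ∀ u ∈ U, X u ∈ U) →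
    ((form n).restrict U).Nondegenerate → U = ⊥ ∨ U = ⊤

/-- The torsion module `Λ²V* ⊗ V`: alternating bilinear maps from `V × V` to `V`. -/
def torsionModule (n : ℕ) : Submodule ℝ (Space n →ₗ[ℝ] Space n →ₗ[ℝ] Space n) where
  carrier := {T | ∀ u, T u u = 0}
  add_mem' := by
    intro S T hS hT u
    simp [hS u, hT u]
  zero_mem' := by
    intro u
    simp
  smul_mem' := by
    intro c T hT u
    simp [hT u]

/-- The decomposable tensor `(α ∧ β) ⊗ v`, that is the map
`(u, w) ↦ (α(u) β(w) - β(u) α(w)) v`. -/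
def wedgeTensor {n : ℕ} (α β : Module.Dual ℝ (Space n)) (v : Space n) :
    Space n →ₗ[ℝ] Space n →ₗ[ℝ] Space n :=
  α.smulRight (β.smulRight v) - β.smulRight (α.smulRight v)

/-- The subspace `(A ∧ B) ⊗ U` of `Λ²V* ⊗ V`, for `A, B ⊆ V*` and `U ⊆ V`. -/
def wedgeTensorSpan {n : ℕ} (A B : Submodule ℝ (Module.Dual ℝ (Space n)))
    (U : Submodule ℝ (Space n)) : Submodule ℝ (Space n →ₗ[ℝ] Space n →ₗ[ℝ] Space n) :=
  Submodule.span ℝ {T | ∃ α ∈ A, ∃ β ∈ B, ∃ v ∈ U, T = wedgeTensor α β v}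

/-- The bilinear form `ω(x, y) = ⟨T(x, y), e₊⟩` on `V₀ = ℝⁿ`. -/
def screenForm {n : ℕ} (T : Space n →ₗ[ℝ] Space n →ₗ[ℝ] Space n) :
    LinearMap.BilinForm ℝ (EuclideanSpace ℝ (Fin n)) :=
  (T.compl₁₂ (incl n) (incl n)).compr₂ ((form n).flip (ePlus n))

end Minkowski

end

namespace Minkowski

variable {n : ℕ}

/-! Lowering an index turns an invariant `T` into an invariant trilinear form `L u v w = ⟨T u v,
w⟩`. Its components in the Witt basis are graded by the number of `e₋` slots minus the number of
`e₊` slots, from 2 down to -2. Evaluating invariance under `X` on a component of degree d gives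
three kinds of terms: the rotation part acting on that component, `d * prReal n X` times the
component, and components of degree d + 1 contracted with the translation part. The components are
therefore treated from the top degree downwards, by two vanishing principles.

If `prReal n X ≠ 0`, a component of degree d ≠ 0 not fed from above is an eigenvector, with nonzero
real eigenvalue, of a skew endomorphism, so it vanishes (`eq_zero_of_skew_eigen`).

Otherwise indecomposability is used (`eq_zero_of_equivariant`). A rotation-equivariant `c` whose
contraction with translation parts is the variation of some `f` yields an equivariant map `(f, c)`
into `e₋^⊥`. If `c ≠ 0`, the image of `(ker c)^⊥` is a nonzero positive definite invariant subspace
of `e₋^⊥`, which is excluded.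

These kill all degrees ≥ 0. If `prReal` is not zero on `h`, degrees -1 and -2 die as well. If it is
zero on `h`, applying the second principle with `f = L(e₊, ·, e₊)` gives the relation between `b`,
`ω` and `T(e₊, ·)`. -/

@[simp]
theorem form_apply (u v : Space n) :
    form n u v = u.1 * v.2.2 + inner ℝ u.2.1 v.2.1 + u.2.2 * v.1 := rfl

theorem incl_apply (x : EuclideanSpace ℝ (Fin n)) : incl n x = (0, x, 0) := rfl

theorem eq_add (u : Space n) : u = u.1 • eMinus n + incl n u.2.1 + u.2.2 • ePlus n := by
  ext <;> simp [eMinus, ePlus, incl_apply]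

/-! ### Matrix entries of elements of 𝔭 in the Witt basis -/

/-- The `ℝⁿ`-part of an element of `(ℝ ⊕ 𝔰𝔬(n)) ⋉ ℝⁿ`. -/
def translationPart (X : Module.End ℝ (Space n)) : EuclideanSpace ℝ (Fin n) := (X (ePlus n)).2.1

/-- The `𝔰𝔬(n)`-part of an element of `(ℝ ⊕ 𝔰𝔬(n)) ⋉ ℝⁿ`. -/
def rotationPart (X : Module.End ℝ (Space n)) :
    EuclideanSpace ℝ (Fin n) →ₗ[ℝ] EuclideanSpace ℝ (Fin n) :=
  LinearMap.fst ℝ _ ℝ ∘ₗ LinearMap.snd ℝ ℝ _ ∘ₗ X ∘ₗ incl n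

theorem form_skew {X : Module.End ℝ (Space n)} (hX : X ∈ parabolic n) (u v : Space n) :
    form n (X u) v = -form n u (X v) := by
  have := hX.1
  have := (LinearMap.mem_skewAdjointSubmodule (B := form n) X).1 this u v
  simpa only [Pi.neg_apply, map_neg] using this

theorem apply_eMinus {X : Module.End ℝ (Space n)} (hX : X ∈ parabolic n) :
    X (eMinus n) = prReal n X • eMinus n := by
  obtain ⟨a, ha⟩ := Submodule.mem_span_singleton.1 hX.2
  have : prReal n X = a := by
    change (X (eMinus n)).1 = a
    rw [← ha]; simp [eMinus]
  rw [this, ha]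

theorem apply_incl {X : Module.End ℝ (Space n)} (hX : X ∈ parabolic n)
    (x : EuclideanSpace ℝ (Fin n)) :
    X (incl n x) = incl n (rotationPart X x) - inner ℝ (translationPart X) x • eMinus n := by
  have h1 := form_skew hX (incl n x) (eMinus n)
  have h2 := form_skew hX (incl n x) (ePlus n)
  rw [apply_eMinus hX] at h1
  simp [eMinus, ePlus, incl_apply] at h1 h2
  ext
  · simp [eMinus, incl_apply, translationPart, h2, real_inner_comm, ePlus]
  · simp [rotationPart, eMinus, incl_apply]
  · simp [eMinus, h1, incl_apply]

theorem apply_ePlus {X : Module.End ℝ (Space n)} (hX : X ∈ parabolic n) :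
    X (ePlus n) = incl n (translationPart X) - prReal n X • ePlus n := by
  have h1 := form_skew hX (ePlus n) (eMinus n)
  have h2 := form_skew hX (ePlus n) (ePlus n)
  rw [apply_eMinus hX] at h1
  simp [eMinus, ePlus] at h1 h2
  ext
  · simp [ePlus, incl_apply]; linarith
  · simp [translationPart, ePlus, incl_apply]
  · simp [ePlus, h1, incl_apply]

theorem inner_rotationPart {X : Module.End ℝ (Space n)} (hX : X ∈ parabolic n)
    (x y : EuclideanSpace ℝ (Fin n)) :
    inner ℝ (rotationPart X x) y = -inner ℝ x (rotationPart X y) := by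
  have h1 := form_skew hX (incl n x) (incl n y)
  rw [apply_incl hX, apply_incl hX] at h1
  simpa [eMinus, incl_apply] using h1

/-! ### The two vanishing principles -/

section Invariants

variable {M : Type*} [NormedAddCommGroup M] [InnerProductSpace ℝ M] [FiniteDimensional ℝ M]

/-- A skew-symmetric endomorphism has no non-zero real eigenvalue on the dual space. -/
theorem eq_zero_of_skew_eigen {D : M →ₗ[ℝ] M} (hD : ∀ m m', inner ℝ (D m) m' = -inner ℝ m (D m'))
    {k : ℝ} (hk : k ≠ 0) {f : M →ₗ[ℝ] ℝ} (hf : ∀ m, f (D m) = k * f m) : f = 0 := by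
  set w := (InnerProductSpace.toDual ℝ M).symm f.toContinuousLinearMap with hw
  have key : ∀ m, f m = inner ℝ w m := fun m => by
    rw [hw, InnerProductSpace.toDual_symm_apply]; rfl
  have h1 := hD w w
  have h2 := hf w
  rw [key, key] at h2
  have h3 : inner ℝ (D w) w = (inner ℝ w (D w) : ℝ) := real_inner_comm _ _
  have h4 : w = 0 := by
    have : k * inner ℝ w w = (0 : ℝ) := by linarith
    exact inner_self_eq_zero.1 ((mul_eq_zero.1 this).resolve_left hk)
  ext m
  rw [key, h4]; simp

/-- The extension `0 → V₋ → e₋^⊥ → V₀ → 0` of modules over an indecomposable Lie algebra does not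
split over a non-zero submodule of `V₀`. -/
theorem eq_zero_of_equivariant {h : LieSubalgebra ℝ (Module.End ℝ (Space n))}
    (h_le : h ≤ parabolic n) (h_ind : IsIndecomposable h)
    (D : Module.End ℝ (Space n) → M →ₗ[ℝ] M)
    (hD : ∀ X ∈ h, ∀ m m', inner ℝ (D X m) m' = -inner ℝ m (D X m'))
    (c : M →ₗ[ℝ] EuclideanSpace ℝ (Fin n) →ₗ[ℝ] ℝ) (f : M →ₗ[ℝ] ℝ)
    (hc : ∀ X ∈ h, ∀ m y, c (D X m) y = -c m (rotationPart X y))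
    (hf : ∀ X ∈ h, ∀ m, f (D X m) = prReal n X * f m - c m (translationPart X)) : c = 0 := by
  let C : M →ₗ[ℝ] EuclideanSpace ℝ (Fin n) :=
    (InnerProductSpace.toDual ℝ (EuclideanSpace ℝ (Fin n))).symm.toLinearEquiv.toLinearMap ∘ₗ
      LinearMap.toContinuousLinearMap.toLinearMap ∘ₗ c
  have hC : ∀ m y, inner ℝ (C m) y = c m y := fun m y => by
    change inner ℝ ((InnerProductSpace.toDual ℝ _).symm (c m).toContinuousLinearMap) y = _
    rw [InnerProductSpace.toDual_symm_apply]; rfl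
  have hCD : ∀ X ∈ h, ∀ m, C (D X m) = rotationPart X (C m) := fun X hX m => by
    refine ext_inner_right ℝ fun y => ?_
    rw [hC, hc X hX, inner_rotationPart (h_le hX), hC]
  -- The values lie in `e₋^⊥`; `hCD` and `hf` together say that `g` intertwines `D X` with `X`.
  let g : M →ₗ[ℝ] Space n := f.prod (C.prod 0)
  have hg : ∀ m, g m = (f m, C m, 0) := fun m => rfl
  have hXg : ∀ X ∈ h, ∀ m, X (g m) = g (D X m) := fun X hX m => by
    rw [eq_add (g m), map_add, map_add, map_smul, apply_eMinus (h_le hX), apply_incl (h_le hX)]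
    ext <;> simp [hg, eMinus, incl_apply, hCD X hX, hf X hX, ← hC, real_inner_comm, mul_comm, sub_eq_add_neg]
  -- `ker C` is stable under the skew maps `D X`, hence so is its complement `K`, on which `C` is
  -- injective.
  let K : Submodule ℝ M := (LinearMap.ker C)ᗮ
  have hK : ∀ X ∈ h, ∀ m ∈ K, D X m ∈ K := fun X hX m hm => by
    refine (Submodule.mem_orthogonal' _ _).2 fun m' hm' => ?_
    rw [hD X hX, (Submodule.mem_orthogonal' _ _).1 hm, neg_zero]
    rw [LinearMap.mem_ker] at hm' ⊢
    rw [hCD X hX, hm', map_zero]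
  have hker : ∀ m ∈ K, C m = 0 → m = 0 := fun m hm h0 =>
    inner_self_eq_zero.1 ((Submodule.mem_orthogonal' _ _).1 hm m h0)
  -- On `e₋^⊥` the form only sees the `V₀` part, so on `g(K)` it is `‖C m‖²`, which is positive
  -- definite.
  have hU := h_ind (K.map g)
    (by
      rintro X hX _ ⟨m, hm, rfl⟩
      exact ⟨D X m, hK X hX m hm, (hXg X hX m).symm⟩)
    (by
      have hs : ∀ u ∈ K.map g, form n u u = 0 → u = 0 := by
        rintro _ ⟨m, hm, rfl⟩ h0
        have : C m = 0 := by simpa [hg] using h0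
        rw [hker m hm this, map_zero]
      constructor
      · exact fun u hu => Subtype.ext (hs u u.2 (hu u))
      · exact fun u hu => Subtype.ext (hs u u.2 (hu u)))
  have hgK : ∀ m ∈ K, C m = 0 := by
    rcases hU with hU | hU
    · intro m hm
      have : g m ∈ K.map g := ⟨m, hm, rfl⟩
      rw [hU, Submodule.mem_bot, hg] at this
      exact congrArg (fun u : Space n => u.2.1) this
    · have : ePlus n ∈ K.map g := hU ▸ Submodule.mem_top
      obtain ⟨m, -, hm⟩ := this
      have := congrArg (fun u : Space n => u.2.2) hm
      simp [hg, ePlus] at this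
  have hKbot : K = ⊥ := (Submodule.eq_bot_iff _).2 fun m hm => hker m hm (hgK m hm)
  have hC0 : ∀ m, C m = 0 := fun m => by
    have : m ∈ LinearMap.ker C := by
      rw [(Submodule.orthogonal_eq_bot_iff).1 hKbot]; exact Submodule.mem_top
    exact this
  ext m y
  rw [← hC, hC0]; simp

end Invariants

/-! ### Bilinear versions, through the tensor square -/

open scoped TensorProduct

/-- The derivation `D ⊗ 1 + 1 ⊗ D` on the tensor square. -/
def tensorDerivation {E : Type*} [AddCommGroup E] [Module ℝ E] (D : E →ₗ[ℝ] E) :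
    E ⊗[ℝ] E →ₗ[ℝ] E ⊗[ℝ] E :=
  TensorProduct.map D LinearMap.id + TensorProduct.map LinearMap.id D

theorem inner_tensorDerivation {E : Type*} [NormedAddCommGroup E] [InnerProductSpace ℝ E]
    {D : E →ₗ[ℝ] E} (hD : ∀ x y, inner ℝ (D x) y = -inner ℝ x (D y)) (m m' : E ⊗[ℝ] E) :
    inner ℝ (tensorDerivation D m) m' = -inner ℝ m (tensorDerivation D m') := by
  induction m with
  | zero => simp
  | add a b ha hb => rw [map_add, inner_add_left, ha, hb, inner_add_left]; ring
  | tmul x y =>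
    induction m' with
    | zero => simp
    | add a b ha hb => rw [map_add, inner_add_right, ha, hb, inner_add_right]; ring
    | tmul x' y' =>
      simp [tensorDerivation, inner_add_left, inner_add_right, TensorProduct.inner_tmul, hD]
      ring

theorem bilin_eq_zero_of_skew_eigen {E : Type*} [NormedAddCommGroup E] [InnerProductSpace ℝ E]
    [FiniteDimensional ℝ E] {D : E →ₗ[ℝ] E} (hD : ∀ x y, inner ℝ (D x) y = -inner ℝ x (D y))
    {k : ℝ} (hk : k ≠ 0) {f : E →ₗ[ℝ] E →ₗ[ℝ] ℝ}
    (hf : ∀ x y, f (D x) y + f x (D y) = k * f x y) : f = 0 := by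
  have := eq_zero_of_skew_eigen (inner_tensorDerivation hD) hk (f := TensorProduct.lift f)
    (fun m => by
      induction m with
      | zero => simp
      | add a b ha hb => rw [map_add, map_add, ha, hb, map_add]; ring
      | tmul x y => simpa [tensorDerivation] using hf x y)
  ext x y
  simpa using congrArg (fun F => F (x ⊗ₜ[ℝ] y)) this

/-- The Euclidean module is `V₀ ⊗ V₀`, on which the derivation extending a skew map is again skew.
-/
theorem bilin_eq_zero_of_equivariant {h : LieSubalgebra ℝ (Module.End ℝ (Space n))}
    (h_le : h ≤ parabolic n) (h_ind : IsIndecomposable h)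
    (c : EuclideanSpace ℝ (Fin n) →ₗ[ℝ] EuclideanSpace ℝ (Fin n) →ₗ[ℝ]
      EuclideanSpace ℝ (Fin n) →ₗ[ℝ] ℝ)
    (f : EuclideanSpace ℝ (Fin n) →ₗ[ℝ] EuclideanSpace ℝ (Fin n) →ₗ[ℝ] ℝ)
    (hc : ∀ X ∈ h, ∀ x y z, c (rotationPart X x) y z + c x (rotationPart X y) z =
      -c x y (rotationPart X z))
    (hf : ∀ X ∈ h, ∀ x y, f (rotationPart X x) y + f x (rotationPart X y) =
      prReal n X * f x y - c x y (translationPart X)) : c = 0 := by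
  have := eq_zero_of_equivariant h_le h_ind (fun X => tensorDerivation (rotationPart X))
    (fun X hX => inner_tensorDerivation (inner_rotationPart (h_le hX)))
    (TensorProduct.lift c) (TensorProduct.lift f)
    (fun X hX m z => by
      induction m with
      | zero => simp
      | add a b ha hb =>
        rw [map_add, map_add, LinearMap.add_apply, ha, hb, map_add, LinearMap.add_apply]; ring
      | tmul x y => simpa [tensorDerivation] using hc X hX x y z)
    (fun X hX m => by
      induction m with
      | zero => simp
      | add a b ha hb =>
        rw [map_add, map_add, ha, hb, map_add, map_add, LinearMap.add_apply]; ring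
      | tmul x y => simpa [tensorDerivation] using hf X hX x y)
  ext x y z
  simpa using congrArg (fun F => F (x ⊗ₜ[ℝ] y) z) this

/-! ### Components of degree 2, 1 and 0 -/

section Components

/-- The invariance of a trilinear form under a Lie algebra of endomorphisms. -/
def IsInvariant (h : LieSubalgebra ℝ (Module.End ℝ (Space n)))
    (L : Space n →ₗ[ℝ] Space n →ₗ[ℝ] Space n →ₗ[ℝ] ℝ) : Prop :=
  ∀ X ∈ h, ∀ u v w, L (X u) v w + L u (X v) w + L u v (X w) = 0

variable {h : LieSubalgebra ℝ (Module.End ℝ (Space n))}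
  {L : Space n →ₗ[ℝ] Space n →ₗ[ℝ] Space n →ₗ[ℝ] ℝ}

/-- In the top degree no translation term survives, so the component is a functional on `V₀` of
weight `-2 * prReal n X`. -/
theorem component_minus_zero_minus (h_le : h ≤ parabolic n) (h_ind : IsIndecomposable h)
    (hL : ∀ u v w, L u v w = -L v u w) (hinv : IsInvariant h L) (x : EuclideanSpace ℝ (Fin n)) :
    L (eMinus n) (incl n x) (eMinus n) = 0 := by
  have h0 : L (eMinus n) (eMinus n) (eMinus n) = 0 := by linarith [hL (eMinus n) (eMinus n) (eMinus n)]
  let p : EuclideanSpace ℝ (Fin n) →ₗ[ℝ] ℝ := (L (eMinus n)).flip (eMinus n) ∘ₗ incl n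
  have hp : ∀ X ∈ h, ∀ x, p (rotationPart X x) = (-2 * prReal n X) * p x := fun X hX x => by
    have := hinv X hX (eMinus n) (incl n x) (eMinus n)
    simp only [apply_eMinus (h_le hX), apply_incl (h_le hX), map_smul, map_sub,
      LinearMap.smul_apply, LinearMap.sub_apply, smul_eq_mul, h0] at this
    simp only [p, LinearMap.comp_apply, LinearMap.flip_apply]
    linarith
  change p x = 0
  by_cases ha : ∀ X ∈ h, prReal n X = 0
  -- With `M = ℝ` acted on trivially, it is enough that `p` kills all translation parts; this is
  -- invariance at `(e₋, e₊, e₋)`.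
  · have := eq_zero_of_equivariant (M := ℝ) h_le h_ind (fun _ => 0) (by simp)
      (LinearMap.toSpanSingleton ℝ _ p)
      (LinearMap.toSpanSingleton ℝ _ (-L (eMinus n) (ePlus n) (eMinus n)))
      (fun X hX m y => by simp [hp X hX, ha X hX])
      (fun X hX m => by
        have := hinv X hX (eMinus n) (ePlus n) (eMinus n)
        simp only [apply_eMinus (h_le hX), apply_ePlus (h_le hX), map_smul, map_sub,
          LinearMap.smul_apply, LinearMap.sub_apply, smul_eq_mul, ha X hX] at this
        have h1 : p (translationPart X) = 0 := by
          simp only [p, LinearMap.comp_apply, LinearMap.flip_apply]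
          linarith
        simp [h1, ha X hX])
    simpa using congrArg (fun F => F 1 x) this
  · push Not at ha
    obtain ⟨X, hX, ha⟩ := ha
    rw [eq_zero_of_skew_eigen (inner_rotationPart (h_le hX)) (k := -2 * prReal n X) (by simpa using ha)
      (hp X hX)]
    simp

/-- When `prReal` vanishes on `h`, each component of degree 1 is paired with one of degree 0 playing
the role of `f`. The order matters: `β = 0` is needed for the scalar `L(e₋, e₊, e₋)`, and that for
`α`. -/
theorem components_degree_one (hn : 2 ≤ n) (h_le : h ≤ parabolic n) (h_ind : IsIndecomposable h)
    (hL : ∀ u v w, L u v w = -L v u w) (hinv : IsInvariant h L) :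
    (∀ x y, L (incl n x) (incl n y) (eMinus n) = 0) ∧
    (∀ x y, L (eMinus n) (incl n x) (incl n y) = 0) ∧
    L (eMinus n) (ePlus n) (eMinus n) = 0 := by
  have h0 : ∀ w, L (eMinus n) (eMinus n) w = 0 := fun w => by linarith [hL (eMinus n) (eMinus n) w]
  have hp := component_minus_zero_minus h_le h_ind hL hinv
  have hp' : ∀ x, L (incl n x) (eMinus n) (eMinus n) = 0 := fun x => by rw [hL, hp, neg_zero]
  let α : EuclideanSpace ℝ (Fin n) →ₗ[ℝ] EuclideanSpace ℝ (Fin n) →ₗ[ℝ] ℝ :=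
    (L.compl₁₂ (incl n) (incl n)).compr₂ (LinearMap.applyₗ (eMinus n))
  let β : EuclideanSpace ℝ (Fin n) →ₗ[ℝ] EuclideanSpace ℝ (Fin n) →ₗ[ℝ] ℝ :=
    (L (eMinus n)).compl₁₂ (incl n) (incl n)
  have eα : ∀ x y, L (incl n x) (incl n y) (eMinus n) = α x y := fun _ _ => rfl
  have eβ : ∀ x y, L (eMinus n) (incl n x) (incl n y) = β x y := fun _ _ => rfl
  have hα : ∀ X ∈ h, ∀ x y, α (rotationPart X x) y + α x (rotationPart X y) =
      -prReal n X * α x y := fun X hX x y => by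
    have := hinv X hX (incl n x) (incl n y) (eMinus n)
    simp only [apply_eMinus (h_le hX), apply_incl (h_le hX), map_smul, map_sub,
      LinearMap.smul_apply, LinearMap.sub_apply, smul_eq_mul, hp, hp', eα] at this
    linarith
  have hβ : ∀ X ∈ h, ∀ x y, β (rotationPart X x) y + β x (rotationPart X y) =
      -prReal n X * β x y := fun X hX x y => by
    have := hinv X hX (eMinus n) (incl n x) (incl n y)
    simp only [apply_eMinus (h_le hX), apply_incl (h_le hX), map_smul, map_sub,
      LinearMap.smul_apply, LinearMap.sub_apply, smul_eq_mul, hp, h0, eβ] at this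
    linarith
  by_cases ha : ∀ X ∈ h, prReal n X = 0
  · have hβ0 : β = 0 := by
      refine eq_zero_of_equivariant h_le h_ind rotationPart
        (fun X hX => inner_rotationPart (h_le hX)) β ((L (eMinus n)).flip (ePlus n) ∘ₗ incl n)
        (fun X hX m y => ?_) (fun X hX m => ?_)
      · have := hβ X hX m y
        rw [ha X hX] at this
        linarith
      · have := hinv X hX (eMinus n) (incl n m) (ePlus n)
        simp only [apply_eMinus (h_le hX), apply_ePlus (h_le hX), apply_incl (h_le hX), map_smul,
          map_sub, LinearMap.smul_apply, LinearMap.sub_apply, smul_eq_mul, h0, eβ, ha X hX] at this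
        simp only [LinearMap.comp_apply, LinearMap.flip_apply, ha X hX]
        linarith
    have hγ0 : L (eMinus n) (ePlus n) (eMinus n) = 0 := by
      have := eq_zero_of_equivariant h_le h_ind rotationPart
        (fun X hX => inner_rotationPart (h_le hX))
        (L (eMinus n) (ePlus n) (eMinus n) • innerₗ (EuclideanSpace ℝ (Fin n)))
        (-(L (eMinus n) (ePlus n) ∘ₗ incl n))
        (fun X hX m y => by simp [inner_rotationPart (h_le hX)])
        (fun X hX m => by
          have := hinv X hX (eMinus n) (ePlus n) (incl n m)
          simp only [apply_eMinus (h_le hX), apply_ePlus (h_le hX), apply_incl (h_le hX), map_smul,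
            map_sub, LinearMap.smul_apply, LinearMap.sub_apply, smul_eq_mul, eβ, hβ0,
            LinearMap.zero_apply, ha X hX] at this
          simp only [LinearMap.comp_apply, LinearMap.neg_apply, LinearMap.smul_apply,
            innerₗ_apply_apply, smul_eq_mul, ha X hX]
          rw [real_inner_comm]
          linarith)
      have e := congrArg (fun F => F (EuclideanSpace.single ⟨0, by omega⟩ 1)
        (EuclideanSpace.single ⟨0, by omega⟩ 1)) this
      simpa using e
    have hα0 : α.flip = 0 := by
      refine eq_zero_of_equivariant h_le h_ind rotationPart
        (fun X hX => inner_rotationPart (h_le hX)) α.flip ((L (ePlus n)).flip (eMinus n) ∘ₗ incl n)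
        (fun X hX m y => ?_) (fun X hX m => ?_)
      · have := hα X hX y m
        rw [ha X hX] at this
        simp only [LinearMap.flip_apply]
        linarith
      · have := hinv X hX (ePlus n) (incl n m) (eMinus n)
        simp only [apply_eMinus (h_le hX), apply_ePlus (h_le hX), apply_incl (h_le hX), map_smul,
          map_sub, LinearMap.smul_apply, LinearMap.sub_apply, smul_eq_mul, eα, ha X hX,
          hL (ePlus n) (eMinus n), hγ0] at this
        simp only [LinearMap.comp_apply, LinearMap.flip_apply, ha X hX]
        linarith
    exact ⟨fun x y => congrArg (fun F => F y x) hα0, fun x y => congrArg (fun F => F x y) hβ0, hγ0⟩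
  · push Not at ha
    obtain ⟨X, hX, ha⟩ := ha
    have hα0 := bilin_eq_zero_of_skew_eigen (inner_rotationPart (h_le hX)) (neg_ne_zero.2 ha)
      (hα X hX)
    have hβ0 := bilin_eq_zero_of_skew_eigen (inner_rotationPart (h_le hX)) (neg_ne_zero.2 ha)
      (hβ X hX)
    refine ⟨fun x y => congrArg (fun F => F x y) hα0, fun x y => congrArg (fun F => F x y) hβ0, ?_⟩
    have := hinv X hX (eMinus n) (ePlus n) (eMinus n)
    simp only [apply_eMinus (h_le hX), apply_ePlus (h_le hX), map_smul, map_sub,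
      LinearMap.smul_apply, LinearMap.sub_apply, smul_eq_mul, hp] at this
    refine (mul_eq_zero.1 ?_).resolve_left ha
    linarith

/-- In degree 0 the weight is zero, so no case distinction on `prReal` is needed. The three
components of degree -1, taken as `f`, give three linear relations between `τ`, `lam`, `κ` and `μ`,
which force all four to vanish. -/
theorem components_degree_zero (hn : 2 ≤ n) (h_le : h ≤ parabolic n) (h_ind : IsIndecomposable h)
    (hL : ∀ u v w, L u v w = -L v u w) (hinv : IsInvariant h L) :
    (∀ x y z, L (incl n x) (incl n y) (incl n z) = 0) ∧
    (∀ x, L (eMinus n) (incl n x) (ePlus n) = 0) ∧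
    (∀ x, L (eMinus n) (ePlus n) (incl n x) = 0) ∧
    ∀ x, L (ePlus n) (incl n x) (eMinus n) = 0 := by
  have h0 : ∀ w, L (eMinus n) (eMinus n) w = 0 := fun w => by linarith [hL (eMinus n) (eMinus n) w]
  obtain ⟨hα, hβ, hγ⟩ := components_degree_one hn h_le h_ind hL hinv
  have hβ' : ∀ x y, L (incl n x) (eMinus n) (incl n y) = 0 := fun x y => by rw [hL, hβ, neg_zero]
  let τ : EuclideanSpace ℝ (Fin n) →ₗ[ℝ] EuclideanSpace ℝ (Fin n) →ₗ[ℝ]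
      EuclideanSpace ℝ (Fin n) →ₗ[ℝ] ℝ :=
    (L.compl₁₂ (incl n) (incl n)).compr₂ (LinearMap.lcomp ℝ ℝ (incl n))
  let lam : EuclideanSpace ℝ (Fin n) →ₗ[ℝ] ℝ := (L (eMinus n)).flip (ePlus n) ∘ₗ incl n
  let κ : EuclideanSpace ℝ (Fin n) →ₗ[ℝ] ℝ := L (eMinus n) (ePlus n) ∘ₗ incl n
  let μ : EuclideanSpace ℝ (Fin n) →ₗ[ℝ] ℝ := (L (ePlus n)).flip (eMinus n) ∘ₗ incl n
  have eτ : ∀ x y z, L (incl n x) (incl n y) (incl n z) = τ x y z := fun _ _ _ => rfl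
  have el : ∀ x, L (eMinus n) (incl n x) (ePlus n) = lam x := fun _ => rfl
  have eκ : ∀ x, L (eMinus n) (ePlus n) (incl n x) = κ x := fun _ => rfl
  have eμ : ∀ x, L (ePlus n) (incl n x) (eMinus n) = μ x := fun _ => rfl
  have el' : ∀ x, L (incl n x) (eMinus n) (ePlus n) = -lam x := fun x => by rw [hL, el]
  have eκ' : ∀ x, L (ePlus n) (eMinus n) (incl n x) = -κ x := fun x => by rw [hL, eκ]
  have hτS : ∀ X ∈ h, ∀ x y z, τ (rotationPart X x) y z + τ x (rotationPart X y) z +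
      τ x y (rotationPart X z) = 0 := fun X hX x y z => by
    have := hinv X hX (incl n x) (incl n y) (incl n z)
    simp only [apply_incl (h_le hX), map_smul, map_sub,
      LinearMap.smul_apply, LinearMap.sub_apply, smul_eq_mul, hα, hβ, hβ', eτ] at this
    linarith
  have hlS : ∀ X ∈ h, ∀ x, lam (rotationPart X x) = 0 := fun X hX x => by
    have := hinv X hX (eMinus n) (incl n x) (ePlus n)
    simp only [apply_eMinus (h_le hX), apply_ePlus (h_le hX), apply_incl (h_le hX), map_smul,
      map_sub, LinearMap.smul_apply, LinearMap.sub_apply, smul_eq_mul, h0, hβ, el] at this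
    linarith
  have hκS : ∀ X ∈ h, ∀ x, κ (rotationPart X x) = 0 := fun X hX x => by
    have := hinv X hX (eMinus n) (ePlus n) (incl n x)
    simp only [apply_eMinus (h_le hX), apply_ePlus (h_le hX), apply_incl (h_le hX), map_smul,
      map_sub, LinearMap.smul_apply, LinearMap.sub_apply, smul_eq_mul, hγ, hβ, eκ] at this
    linarith
  have hμS : ∀ X ∈ h, ∀ x, μ (rotationPart X x) = 0 := fun X hX x => by
    have := hinv X hX (ePlus n) (incl n x) (eMinus n)
    simp only [apply_eMinus (h_le hX), apply_ePlus (h_le hX), apply_incl (h_le hX), map_smul,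
      map_sub, LinearMap.smul_apply, LinearMap.sub_apply, smul_eq_mul, hL (ePlus n) (eMinus n),
      hγ, hα, eμ] at this
    linarith
  have hc₁ := bilin_eq_zero_of_equivariant h_le h_ind
    (τ + ((-lam).smulRight (innerₗ (EuclideanSpace ℝ (Fin n)))).flip +
      lam.smulRight (innerₗ (EuclideanSpace ℝ (Fin n))))
    ((L.compl₁₂ (incl n) (incl n)).compr₂ (LinearMap.applyₗ (ePlus n)))
    (fun X hX x y z => by
      have := hτS X hX x y z
      simp [hlS X hX, inner_rotationPart (h_le hX)]
      linarith)
    (fun X hX x y => by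
      have := hinv X hX (incl n x) (incl n y) (ePlus n)
      simp only [apply_ePlus (h_le hX), apply_incl (h_le hX), map_smul,
        map_sub, LinearMap.smul_apply, LinearMap.sub_apply, smul_eq_mul, el, el', eτ] at this
      simp [real_inner_comm (translationPart X)]
      linarith)
  have hc₂ := bilin_eq_zero_of_equivariant h_le h_ind
    (LinearMap.lflip.toLinearMap ∘ₗ τ.flip + (κ.smulRight (innerₗ (EuclideanSpace ℝ (Fin n)))).flip +
      (-μ).smulRight (innerₗ (EuclideanSpace ℝ (Fin n))))
    ((L (ePlus n)).compl₁₂ (incl n) (incl n))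
    (fun X hX x y z => by
      have := hτS X hX z x y
      simp [hκS X hX, hμS X hX, inner_rotationPart (h_le hX)]
      linarith)
    (fun X hX x y => by
      have := hinv X hX (ePlus n) (incl n x) (incl n y)
      simp only [apply_ePlus (h_le hX), apply_incl (h_le hX), map_smul,
        map_sub, LinearMap.smul_apply, LinearMap.sub_apply, smul_eq_mul, eκ', eμ, eτ] at this
      simp [real_inner_comm (translationPart X)]
      linarith)
  have hc₃ := eq_zero_of_equivariant (M := ℝ) h_le h_ind (fun _ => 0) (by simp)
      (LinearMap.toSpanSingleton ℝ _ (-(lam + κ)))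
      (LinearMap.toSpanSingleton ℝ _ (L (ePlus n) (eMinus n) (ePlus n)))
      (fun X hX m y => by simp [hlS X hX, hκS X hX])
      (fun X hX m => by
        have := hinv X hX (ePlus n) (eMinus n) (ePlus n)
        simp only [apply_eMinus (h_le hX), apply_ePlus (h_le hX), map_smul,
          map_sub, LinearMap.smul_apply, LinearMap.sub_apply, smul_eq_mul, eκ', el'] at this
        simp
        linear_combination m * this)
  have e₁ : ∀ x y z, τ x y z - lam y * inner ℝ x z + lam x * inner ℝ y z = 0 := fun x y z => by
    simpa [← sub_eq_add_neg] using congrArg (fun F => F x y z) hc₁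
  have e₂ : ∀ x y z, τ z x y + κ y * inner ℝ x z - μ x * inner ℝ y z = 0 := fun x y z => by
    simpa [← sub_eq_add_neg] using congrArg (fun F => F x y z) hc₂
  have e₃ : ∀ x, κ x = -lam x := fun x => by
    have : -κ x + -lam x = 0 := by simpa using congrArg (fun F => F 1 x) hc₃
    linarith
  -- A unit vector orthogonal to a given basis vector exists because `2 ≤ n`.
  have hunit : ∀ i : Fin n, ∃ x : EuclideanSpace ℝ (Fin n), inner ℝ x x = (1 : ℝ) ∧
      inner ℝ x (EuclideanSpace.single i (1 : ℝ)) = (0 : ℝ) := fun i => by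
    have : Nontrivial (Fin n) := Fin.nontrivial_iff_two_le.2 hn
    obtain ⟨j, hj⟩ := exists_ne i
    exact ⟨EuclideanSpace.single j (1 : ℝ), by simp,
      by simp [EuclideanSpace.inner_single_left, hj]⟩
  have hl0 : lam = 0 := by
    refine (EuclideanSpace.basisFun (Fin n) ℝ).toBasis.ext fun i => ?_
    obtain ⟨x, hx, hxy⟩ := hunit i
    simp only [OrthonormalBasis.coe_toBasis, EuclideanSpace.basisFun_apply, LinearMap.zero_apply]
    set y := EuclideanSpace.single i (1 : ℝ)
    have hyx : inner ℝ y x = (0 : ℝ) := by rw [real_inner_comm, hxy]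
    -- For `x` a unit vector orthogonal to `y`, `e₁` gives `τ x x y = 0`, while `e₂` and `e₃` give
    -- `τ x x y = lam y`.
    have h1 := e₁ x x y
    have h2 := e₂ x y x
    have h3 := e₃ y
    rw [hxy] at h1
    rw [hx, hyx, h3] at h2
    linarith
  have hκ0 : ∀ x, κ x = 0 := fun x => by rw [e₃, hl0]; simp
  have hτ0 : ∀ x y z, τ x y z = 0 := fun x y z => by
    have := e₁ x y z
    rw [hl0] at this
    simpa using this
  have hμ0 : ∀ x, μ x = 0 := fun x => by
    have := e₂ x (EuclideanSpace.single ⟨0, by omega⟩ 1) (EuclideanSpace.single ⟨0, by omega⟩ 1)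
    rw [hτ0, hκ0] at this
    simpa using this
  exact ⟨hτ0, fun x => by rw [el, hl0]; rfl, hκ0, hμ0⟩

end Components

/-! ### From invariant torsion tensors to trilinear forms -/

theorem isInvariant_of_isTrivial {h : LieSubalgebra ℝ (Module.End ℝ (Space n))}
    (h_le : h ≤ parabolic n)
    {W : LieSubmodule ℝ h (Space n →ₗ[ℝ] Space n →ₗ[ℝ] Space n)} (hW : LieModule.IsTrivial h W)
    {T : Space n →ₗ[ℝ] Space n →ₗ[ℝ] Space n} (hT : T ∈ W) :
    IsInvariant h (T.compr₂ (form n)) := fun X hX u v w => by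
  have h1 : ⁅(⟨X, hX⟩ : h), T⁆ = 0 :=
    congrArg Subtype.val (hW.trivial (⟨X, hX⟩ : h) (⟨T, hT⟩ : W))
  have h2 : X (T u v) - T u (X v) - T (X u) v = 0 := congrArg (fun F => F u v) h1
  have h3 : X (T u v) = T (X u) v + T u (X v) := by
    rw [← sub_eq_zero, ← h2]; abel
  have h4 := form_skew (h_le hX) (T u v) w
  rw [h3, map_add, LinearMap.add_apply] at h4
  simp only [LinearMap.compr₂_apply]
  linarith

theorem torsion_skew {T : Space n →ₗ[ℝ] Space n →ₗ[ℝ] Space n} (hT : T ∈ torsionModule n)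
    (u v : Space n) : T u v = -T v u := by
  have h1 : T (u + v) (u + v) = 0 := hT (u + v)
  have h2 : T u u = 0 := hT u
  have h3 : T v v = 0 := hT v
  rw [map_add, map_add, LinearMap.add_apply, LinearMap.add_apply, h2, h3, zero_add, add_zero] at h1
  rw [eq_neg_iff_add_eq_zero, add_comm, h1]

theorem eq_of_form_eq {z : Space n} {a b : ℝ} {x : EuclideanSpace ℝ (Fin n)}
    (hm : form n z (eMinus n) = b) (h0 : ∀ y, form n z (incl n y) = inner ℝ x y)
    (hp : form n z (ePlus n) = a) : z = a • eMinus n + incl n x + b • ePlus n := by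
  ext1
  · simpa [eMinus, ePlus, incl_apply] using hp
  · ext1
    · refine ext_inner_right ℝ fun y => ?_
      simpa [eMinus, ePlus, incl_apply] using h0 y
    · simpa [eMinus, ePlus, incl_apply] using hm

/-- The vanishing of all components of an invariant torsion tensor of non-negative degree. -/
theorem torsion_components (hn : 2 ≤ n) {h : LieSubalgebra ℝ (Module.End ℝ (Space n))}
    (h_le : h ≤ parabolic n) (h_ind : IsIndecomposable h)
    {T : Space n →ₗ[ℝ] Space n →ₗ[ℝ] Space n} (hT : T ∈ torsionModule n)
    (hinv : IsInvariant h (T.compr₂ (form n))) :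
    (∀ x, T (eMinus n) (incl n x) = 0) ∧
    (T (ePlus n) (eMinus n) = form n (T (ePlus n) (eMinus n)) (ePlus n) • eMinus n) ∧
    (∀ x y, T (incl n x) (incl n y) = screenForm T x y • eMinus n) ∧
    ∀ x, T (ePlus n) (incl n x) = form n (T (ePlus n) (incl n x)) (ePlus n) • eMinus n +
      incl n (T (ePlus n) (incl n x)).2.1 := by
  have hL : ∀ u v w, (T.compr₂ (form n)) u v w = -(T.compr₂ (form n)) v u w := fun u v w => by
    rw [LinearMap.compr₂_apply, torsion_skew hT, map_neg]; rfl
  have h2 := component_minus_zero_minus h_le h_ind hL hinv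
  obtain ⟨hα, hβ, hγ⟩ := components_degree_one hn h_le h_ind hL hinv
  obtain ⟨hτ, hl, hκ, hμ⟩ := components_degree_zero hn h_le h_ind hL hinv
  simp only [LinearMap.compr₂_apply] at h2 hα hβ hγ hτ hl hκ hμ
  refine ⟨fun x => ?_, ?_, fun x y => ?_, fun x => ?_⟩
  · simpa using eq_of_form_eq (h2 x) (x := 0) (fun y => by rw [hβ, inner_zero_left]) (hl x)
  · rw [torsion_skew hT (ePlus n) (eMinus n)]
    have := eq_of_form_eq (z := T (eMinus n) (ePlus n)) hγ (x := 0)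
      (fun y => by rw [hκ, inner_zero_left]) rfl
    rw [map_zero, zero_smul, add_zero, add_zero] at this
    rw [map_neg, LinearMap.neg_apply, neg_smul, ← this]
  · have := eq_of_form_eq (hα x y) (x := 0) (fun y => by rw [hτ, inner_zero_left])
      (rfl : _ = screenForm T x y)
    simpa using this
  · have := eq_of_form_eq (hμ x) (x := (T (ePlus n) (incl n x)).2.1)
      (fun y => by simp [incl_apply]) rfl
    rwa [zero_smul, add_zero] at this

/-! ### Components of negative degree -/

/-- The surviving components have weight `prReal n X` in degree -1 and `2 * prReal n X` in degree
-2, both nonzero. The latter is reached last, since its translation terms involve degree -1. -/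
theorem torsion_eq_zero (hn : 2 ≤ n) {h : LieSubalgebra ℝ (Module.End ℝ (Space n))}
    (h_le : h ≤ parabolic n) (h_ind : IsIndecomposable h)
    {T : Space n →ₗ[ℝ] Space n →ₗ[ℝ] Space n} (hT : T ∈ torsionModule n)
    (hinv : IsInvariant h (T.compr₂ (form n))) {X : Module.End ℝ (Space n)} (hX : X ∈ h)
    (ha : prReal n X ≠ 0) : T = 0 := by
  obtain ⟨h1, h2, h3, h4⟩ := torsion_components hn h_le h_ind hT hinv
  set L := T.compr₂ (form n)
  have hS := inner_rotationPart (h_le hX)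
  have eL : ∀ u v w, L u v w = form n (T u v) w := fun _ _ _ => rfl
  have hb : form n (T (ePlus n) (eMinus n)) (ePlus n) = 0 := by
    have := hinv X hX (ePlus n) (eMinus n) (ePlus n)
    simp only [apply_eMinus (h_le hX), apply_ePlus (h_le hX), map_smul, map_sub,
      LinearMap.smul_apply, LinearMap.sub_apply, smul_eq_mul, eL,
      torsion_skew hT (incl n _) (eMinus n), h1] at this
    rw [h2] at this
    simp [eMinus, ePlus, incl_apply] at this
    rw [h2]
    simpa [eMinus, ePlus, ha] using this
  rw [hb, zero_smul] at h2
  have hω : screenForm T = 0 := by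
    refine bilin_eq_zero_of_skew_eigen hS ha fun x y => ?_
    have := hinv X hX (incl n x) (incl n y) (ePlus n)
    simp only [apply_incl (h_le hX), apply_ePlus (h_le hX), map_smul, map_sub,
      LinearMap.smul_apply, LinearMap.sub_apply, smul_eq_mul, eL,
      torsion_skew hT (incl n _) (eMinus n), h1, h3] at this
    simp [eMinus, ePlus, incl_apply] at this
    linarith
  have h3' : ∀ x y, T (incl n x) (incl n y) = 0 := fun x y => by rw [h3, hω]; simp
  have hq : (L (ePlus n)).compl₁₂ (incl n) (incl n) = 0 := by
    refine bilin_eq_zero_of_skew_eigen hS ha fun x y => ?_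
    have := hinv X hX (ePlus n) (incl n x) (incl n y)
    simp only [apply_incl (h_le hX), apply_ePlus (h_le hX), map_smul, map_sub,
      LinearMap.smul_apply, LinearMap.sub_apply, smul_eq_mul, eL, h3', h2] at this
    rw [show form n (T (ePlus n) (incl n x)) (eMinus n) = 0 by
      rw [h4]; simp [eMinus, incl_apply]] at this
    simp [-form_apply] at this
    simp only [LinearMap.compl₁₂_apply, eL]
    linarith
  have hq' : ∀ x y, form n (T (ePlus n) (incl n x)) (incl n y) = 0 := fun x y =>
    congrArg (fun F => F x y) hq
  have ht : (L (ePlus n)).flip (ePlus n) ∘ₗ incl n = 0 := by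
    refine eq_zero_of_skew_eigen hS (k := 2 * prReal n X) (by simpa using ha) fun x => ?_
    have := hinv X hX (ePlus n) (incl n x) (ePlus n)
    simp only [apply_incl (h_le hX), apply_ePlus (h_le hX), map_smul, map_sub,
      LinearMap.smul_apply, LinearMap.sub_apply, smul_eq_mul, eL, h3', h2, hq'] at this
    simp [-form_apply] at this
    simp only [LinearMap.comp_apply, LinearMap.flip_apply, eL]
    linarith
  have h4' : ∀ x, T (ePlus n) (incl n x) = 0 := fun x => by
    have e : form n (T (ePlus n) (incl n x)) (ePlus n) = 0 := congrArg (fun F => F x) ht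
    have e' : (T (ePlus n) (incl n x)).2.1 = 0 := ext_inner_right ℝ fun y => by
      simpa [incl_apply] using hq' x y
    rw [h4, e, e']; simp
  have hmm : T (eMinus n) (eMinus n) = 0 := hT _
  have hpp : T (ePlus n) (ePlus n) = 0 := hT _
  refine LinearMap.ext₂ fun u w => ?_
  rw [eq_add u, eq_add w]
  simp only [map_add, map_smul, LinearMap.add_apply, LinearMap.smul_apply, h1, h2, h3', h4', hmm, hpp,
    torsion_skew hT (incl n _) (eMinus n), torsion_skew hT (incl n _) (ePlus n),
    torsion_skew hT (eMinus n) (ePlus n)]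
  simp

theorem form_plus_zero (hn : 2 ≤ n) {h : LieSubalgebra ℝ (Module.End ℝ (Space n))}
    (h_le : h ≤ parabolic n) (h_ind : IsIndecomposable h)
    {T : Space n →ₗ[ℝ] Space n →ₗ[ℝ] Space n} (hT : T ∈ torsionModule n)
    (hinv : IsInvariant h (T.compr₂ (form n))) (ha : ∀ X ∈ h, prReal n X = 0)
    (x y : EuclideanSpace ℝ (Fin n)) :
    form n (T (ePlus n) (incl n x)) (incl n y) =
      form n (T (ePlus n) (eMinus n)) (ePlus n) * inner ℝ x y + screenForm T x y := by
  obtain ⟨h1, h2, h3, h4⟩ := torsion_components hn h_le h_ind hT hinv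
  set L := T.compr₂ (form n)
  set b := form n (T (ePlus n) (eMinus n)) (ePlus n) with hb
  have eL : ∀ u v w, L u v w = form n (T u v) w := fun _ _ _ => rfl
  have hω : ∀ X ∈ h, ∀ x y, screenForm T (rotationPart X x) y +
      screenForm T x (rotationPart X y) = 0 := fun X hX x y => by
    have := hinv X hX (incl n x) (incl n y) (ePlus n)
    simp only [apply_incl (h_le hX), apply_ePlus (h_le hX), map_smul, map_sub,
      LinearMap.smul_apply, LinearMap.sub_apply, smul_eq_mul, eL, ha X hX,
      torsion_skew hT (incl n _) (eMinus n), h1, h3] at this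
    simpa [eMinus, ePlus, incl_apply] using this
  let q : EuclideanSpace ℝ (Fin n) →ₗ[ℝ] EuclideanSpace ℝ (Fin n) →ₗ[ℝ] ℝ :=
    (L (ePlus n)).compl₁₂ (incl n) (incl n)
  have eq : ∀ x y, form n (T (ePlus n) (incl n x)) (incl n y) = q x y := fun _ _ => rfl
  have hq : ∀ X ∈ h, ∀ x y, q (rotationPart X x) y + q x (rotationPart X y) = 0 :=
    fun X hX x y => by
      have := hinv X hX (ePlus n) (incl n x) (incl n y)
      simp only [apply_incl (h_le hX), apply_ePlus (h_le hX), map_smul, map_sub,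
        LinearMap.smul_apply, LinearMap.sub_apply, smul_eq_mul, eL, h3, h2, eq, ha X hX] at this
      rw [show form n (T (ePlus n) (incl n x)) (eMinus n) = 0 by
        rw [h4]; simp [eMinus, incl_apply]] at this
      simpa [eMinus, incl_apply] using this
  -- Invariance at `(e₊, x, e₊)` contracts exactly `q - b⟨·,·⟩ - ω` with the translation part; the
  -- sign of `ω` comes from skewness of `T`.
  have key := eq_zero_of_equivariant h_le h_ind rotationPart
    (fun X hX => inner_rotationPart (h_le hX))
    (q + (-b) • innerₗ (EuclideanSpace ℝ (Fin n)) + -(screenForm T))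
    ((L (ePlus n)).flip (ePlus n) ∘ₗ incl n)
    (fun X hX x y => by
      have e₁ := hq X hX x y
      have e₂ := hω X hX x y
      have e₃ := inner_rotationPart (h_le hX) x y
      simp [e₃]
      linarith)
    (fun X hX x => by
      have := hinv X hX (ePlus n) (incl n x) (ePlus n)
      simp only [apply_incl (h_le hX), apply_ePlus (h_le hX), map_smul, map_sub,
        LinearMap.smul_apply, LinearMap.sub_apply, smul_eq_mul, eL, eq, ha X hX, ← hb] at this
      rw [torsion_skew hT (incl n _) (incl n _), h3] at this
      simp only [LinearMap.comp_apply, LinearMap.flip_apply, eL, ha X hX, LinearMap.add_apply,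
        LinearMap.neg_apply, LinearMap.smul_apply, innerₗ_apply_apply, smul_eq_mul]
      rw [real_inner_comm]
      rw [show form n (-(screenForm T x (translationPart X) • eMinus n)) (ePlus n) =
        -screenForm T x (translationPart X) by simp [eMinus, ePlus]] at this
      linarith)
  have e : q x y + -(b * inner ℝ x y) + -(screenForm T x y) = 0 := by
    simpa using congrArg (fun F => F x y) key
  rw [eq]
  linarith

theorem screenForm_isAlt {T : Space n →ₗ[ℝ] Space n →ₗ[ℝ] Space n} (hT : T ∈ torsionModule n) :
    (screenForm T).IsAlt := fun x => by
  change form n (T (incl n x) (incl n x)) (ePlus n) = 0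
  rw [show T (incl n x) (incl n x) = 0 from hT _]; simp

/-! ### Explicit decomposition of the torsion tensor -/

theorem torsion_mem (hn : 2 ≤ n) {h : LieSubalgebra ℝ (Module.End ℝ (Space n))}
    (h_le : h ≤ parabolic n) (h_ind : IsIndecomposable h)
    {T : Space n →ₗ[ℝ] Space n →ₗ[ℝ] Space n} (hT : T ∈ torsionModule n)
    (hinv : IsInvariant h (T.compr₂ (form n))) :
    T ∈ (wedgeTensorSpan ⊤ (dualPlus n) (VMinus n) ⊔
      wedgeTensorSpan (dualZero n) (dualZero n) (VMinus n)) ⊔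
        wedgeTensorSpan (dualZero n) (dualPlus n) (VZero n) := by
  obtain ⟨h1, h2, h3, h4⟩ := torsion_components hn h_le h_ind hT hinv
  set b := form n (T (ePlus n) (eMinus n)) (ePlus n)
  let E : Fin n → Space n := fun i => incl n (EuclideanSpace.single i (1 : ℝ))
  let t : EuclideanSpace ℝ (Fin n) →ₗ[ℝ] ℝ := ((T.compr₂ (form n)) (ePlus n)).flip (ePlus n) ∘ₗ incl n
  let Q : EuclideanSpace ℝ (Fin n) →ₗ[ℝ] EuclideanSpace ℝ (Fin n) :=
    LinearMap.fst ℝ _ ℝ ∘ₗ LinearMap.snd ℝ ℝ _ ∘ₗ T (ePlus n) ∘ₗ incl n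
  have h4' : ∀ x, T (ePlus n) (incl n x) = t x • eMinus n + incl n (Q x) := h4
  -- The signs are negative because `e₊` fills the first slot in `b` and `t`, whereas `V⁺` is the
  -- second factor of the wedge.
  let α : Module.Dual ℝ (Space n) :=
    (-b) • LinearMap.fst ℝ ℝ _ + -(t ∘ₗ LinearMap.fst ℝ _ ℝ ∘ₗ LinearMap.snd ℝ ℝ _)
  have hsum : ∀ x : EuclideanSpace ℝ (Fin n), x = ∑ i, x i • EuclideanSpace.single i (1 : ℝ) :=
    fun x => by
      simpa using ((EuclideanSpace.basisFun (Fin n) ℝ).sum_repr x).symm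
  have hω : ∀ x y, ∑ i, ∑ j, (x i * y j) * screenForm T (EuclideanSpace.single i 1)
      (EuclideanSpace.single j 1) = screenForm T x y := fun x y => by
    conv_rhs => rw [hsum x, hsum y]
    simp only [map_sum, LinearMap.sum_apply, map_smul, LinearMap.smul_apply, smul_eq_mul,
      Finset.mul_sum]
    rw [Finset.sum_comm]
    exact Finset.sum_congr rfl fun i _ => Finset.sum_congr rfl fun j _ => by ring
  have hQ : ∀ x, ∑ i, x i • incl n (Q (EuclideanSpace.single i 1)) = incl n (Q x) := fun x => by
    conv_rhs => rw [hsum x]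
    simp only [map_sum, map_smul]
  have hmm : T (eMinus n) (eMinus n) = 0 := hT _
  have hpp : T (ePlus n) (ePlus n) = 0 := hT _
  have hE : ∀ i (u : Space n), form n (E i) u = u.2.1 i := fun i u => by
    simp [E, incl_apply, EuclideanSpace.inner_single_left]
  have hem : ∀ u : Space n, form n (eMinus n) u = u.2.2 := fun u => by simp [eMinus]
  have hskew : ∀ x y, screenForm T x y = -screenForm T y x := fun x y =>
    ((screenForm_isAlt hT).neg_eq y x).symm
  -- The factor `2⁻¹` compensates for the double sum counting each pair `i ≠ j` twice.
  have hTeq : T = wedgeTensor α (form n (eMinus n)) (eMinus n) +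
      ∑ i, ∑ j, wedgeTensor (form n (E i)) (form n (E j))
        ((2⁻¹ * screenForm T (EuclideanSpace.single i 1) (EuclideanSpace.single j 1)) • eMinus n) +
      ∑ i, wedgeTensor (form n (E i)) (form n (eMinus n))
        (incl n (-Q (EuclideanSpace.single i 1))) := by
    refine LinearMap.ext₂ fun u w => ?_
    have hu : T u w = (-b * (u.1 * w.2.2 - w.1 * u.2.2) - (t u.2.1 * w.2.2 - t w.2.1 * u.2.2) +
        screenForm T u.2.1 w.2.1) • eMinus n + (u.2.2 • incl n (Q w.2.1) - w.2.2 • incl n (Q u.2.1)) := by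
      conv_lhs => rw [eq_add u, eq_add w]
      simp only [map_add, map_smul, LinearMap.add_apply, LinearMap.smul_apply, h1, h2, h3, h4',
        hmm, hpp, torsion_skew hT (incl n _) (eMinus n), torsion_skew hT (incl n _) (ePlus n),
        torsion_skew hT (eMinus n) (ePlus n)]
      module
    have hs : ∑ i, ∑ j, (u.2.1 i * w.2.1 j - w.2.1 i * u.2.1 j) *
        (2⁻¹ * screenForm T (EuclideanSpace.single i 1) (EuclideanSpace.single j 1)) =
        screenForm T u.2.1 w.2.1 := by
      have e₁ := hω u.2.1 w.2.1
      have e₂ := hω w.2.1 u.2.1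
      rw [hskew w.2.1] at e₂
      calc _ = 2⁻¹ * (∑ i, ∑ j, (u.2.1 i * w.2.1 j) * screenForm T (EuclideanSpace.single i 1)
              (EuclideanSpace.single j 1) - ∑ i, ∑ j, (w.2.1 i * u.2.1 j) *
              screenForm T (EuclideanSpace.single i 1) (EuclideanSpace.single j 1)) := by
            rw [← Finset.sum_sub_distrib, Finset.mul_sum]
            refine Finset.sum_congr rfl fun i _ => ?_
            rw [← Finset.sum_sub_distrib, Finset.mul_sum]
            exact Finset.sum_congr rfl fun j _ => by ring
        _ = _ := by rw [e₁, e₂]; ring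
    have hs₂ : ∑ i, (u.2.1 i * w.2.2 - w.2.1 i * u.2.2) • incl n (-Q (EuclideanSpace.single i 1)) =
        u.2.2 • incl n (Q w.2.1) - w.2.2 • incl n (Q u.2.1) := by
      rw [← hQ, ← hQ, Finset.smul_sum, Finset.smul_sum, ← Finset.sum_sub_distrib]
      refine Finset.sum_congr rfl fun i _ => ?_
      rw [map_neg]
      module
    have hwedge : ∀ (a c : Module.Dual ℝ (Space n)) (z : Space n),
        wedgeTensor a c z u w = (a u * c w - a w * c u) • z := fun a c z => by
      simp only [wedgeTensor, LinearMap.sub_apply, LinearMap.smulRight_apply, LinearMap.smul_apply]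
      module
    simp only [LinearMap.add_apply, LinearMap.sum_apply, hwedge, hE, hem, smul_smul,
      ← Finset.sum_smul, hs, hs₂]
    rw [hu]
    have hα : ∀ u : Space n, α u = -b * u.1 - t u.2.1 := fun u => by
      simp [α, sub_eq_add_neg]
    rw [hα, hα]
    module
  have hEm : ∀ i, form n (E i) ∈ dualZero n := fun i => Submodule.subset_span ⟨i, rfl⟩
  have hem' : form n (eMinus n) ∈ dualPlus n := Submodule.mem_span_singleton_self _
  have hem'' : eMinus n ∈ VMinus n := Submodule.mem_span_singleton_self _
  rw [hTeq]
  refine Submodule.add_mem_sup (Submodule.add_mem_sup ?_ ?_) ?_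
  · exact Submodule.subset_span ⟨α, trivial, _, hem', _, hem'', rfl⟩
  · exact Submodule.sum_mem _ fun i _ => Submodule.sum_mem _ fun j _ => Submodule.subset_span
      ⟨_, hEm i, _, hEm j, _, Submodule.smul_mem _ _ hem'', rfl⟩
  · exact Submodule.sum_mem _ fun i _ => Submodule.subset_span
      ⟨_, hEm i, _, hem', _, ⟨_, rfl⟩, rfl⟩

end Minkowski

/-- `h` acts on the bilinear maps `T : V × V → V` by
`(X · T)(u, w) = X T(u, w) - T(X u, w) - T(u, X w)`. -/
theorem mainTheorem7 (n : ℕ) (hn : 2 ≤ n)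
    (h : LieSubalgebra ℝ (Module.End ℝ (Minkowski.Space n)))
    (h_le : h ≤ Minkowski.parabolic n) (h_ind : Minkowski.IsIndecomposable h)
    (W : LieSubmodule ℝ h
      (Minkowski.Space n →ₗ[ℝ] Minkowski.Space n →ₗ[ℝ] Minkowski.Space n))
    (hW : W.toSubmodule ≤ Minkowski.torsionModule n) (hW_triv : LieModule.IsTrivial h W) :
    (h.toSubmodule.map (Minkowski.prReal n) ≠ ⊥ → W = ⊥) ∧
    (h.toSubmodule.map (Minkowski.prReal n) = ⊥ →
      W.toSubmodule ≤
        (Minkowski.wedgeTensorSpan ⊤ (Minkowski.dualPlus n) (Minkowski.VMinus n) ⊔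
          Minkowski.wedgeTensorSpan (Minkowski.dualZero n) (Minkowski.dualZero n)
            (Minkowski.VMinus n)) ⊔
        Minkowski.wedgeTensorSpan (Minkowski.dualZero n) (Minkowski.dualPlus n)
          (Minkowski.VZero n)) ∧
    ∀ T ∈ W, (Minkowski.screenForm T).IsAlt ∧
      ∃ b : ℝ, T (Minkowski.ePlus n) (Minkowski.eMinus n) = b • Minkowski.eMinus n ∧
        ∀ x y : EuclideanSpace ℝ (Fin n),
          Minkowski.form n (T (Minkowski.ePlus n) (Minkowski.incl n x)) (Minkowski.incl n y) =
            b * inner ℝ x y + Minkowski.screenForm T x y := by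
  have hinv := fun T (hT : T ∈ W) => Minkowski.isInvariant_of_isTrivial h_le hW_triv hT
  refine ⟨fun hne => ?_, fun _ T hT => Minkowski.torsion_mem hn h_le h_ind (hW hT) (hinv T hT),
    fun T hT => ⟨Minkowski.screenForm_isAlt (hW hT), _,
      (Minkowski.torsion_components hn h_le h_ind (hW hT) (hinv T hT)).2.1, fun x y => ?_⟩⟩
  · obtain ⟨_, ⟨X, hX, rfl⟩, ha⟩ := Submodule.exists_mem_ne_zero_of_ne_bot hne
    exact (LieSubmodule.eq_bot_iff W).2 fun T hT =>
      Minkowski.torsion_eq_zero hn h_le h_ind (hW hT) (hinv T hT) hX ha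
  · by_cases ha : ∀ X ∈ h, Minkowski.prReal n X = 0
    · exact Minkowski.form_plus_zero hn h_le h_ind (hW hT) (hinv T hT) ha x y
    · push Not at ha
      obtain ⟨X, hX, ha⟩ := ha
      rw [Minkowski.torsion_eq_zero hn h_le h_ind (hW hT) (hinv T hT) hX ha]
      simp [Minkowski.screenForm]
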